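/- Let $\mathbb{D}=\{z\in\mathbb{C}:|z|<1\}$. For functions $f,g$ analytic in $\mathbb{D}$ write $f\prec g$ if there is an analytic $w:\mathbb{D}\to\mathbb{D}$ with $w(0)=0$ and $f(z)=g(w(z))$ for all $z\in\mathbb{D}$; "univalent" means analytic and injective in $\mathbb{D}$. Let $\alpha,\mu$ be real numbers with $0<\mu\le 1$ and $\alpha+\mu\ge 0$, and let $\beta,\gamma,\delta$ be complex numbers with $\beta\ne 0$. Let $\mathcal{R}(\alpha,\beta,\gamma,\delta,\mu)$ be the class of functions $p$ analytic in $\mathbb{D}$ with $p(0)=1$ and $p(z)\neq 0$ in $\mathbb{D}$, for which \[ (p(z))^{\alpha}\left(p(z)+\delta+\frac{zp'(z)}{\beta p(z)+\gamma}\right)^{\mu}\qquad(z\in\mathbb{D}), \] with principal values of the powers, is well-defined as an analytic function in $\mathbb{D}$ (in particular $\beta p(z)+\gamma\neq0$ in $\mathbb{D}$). Theorem. Let $q\in\mathcal{R}(\alpha,\beta,\gamma,\delta,\mu)$ be univalent in $\mathbb{D}$, and set $R(z)=\dfrac{zq'(z)}{\beta q(z)+\gamma}$. Assume that \[ \operatorname{Re}\left((\beta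 q(z)+\gamma)\left(1+\frac{\alpha}{\mu}+\frac{\alpha\delta}{\mu q(z)}\right)\right)>0\qquad(z\in\mathbb{D}) \] and \[ \operatorname{Re}\left(\frac{\alpha}{\mu}\frac{zq'(z)}{q(z)}+\frac{zR'(z)}{R(z)}\right)>0\qquad(z\in\mathbb{D}), \] where at $z=0$ the quotient $zR'(z)/R(z)$ is given its limit $1$. If $p\in\mathcal{R}(\alpha,\beta,\gamma,\delta,\mu)$ satisfies \[ (p(z))^{\alpha}\left(p(z)+\delta+\frac{zp'(z)}{\beta p(z)+\gamma}\right)^{\mu}\prec (q(z))^{\alpha}\left(q(z)+\delta+\frac{zq'(z)}{\beta q(z)+\gamma}\right)^{\mu}, \tag{1} \] then $p\prec q$. Moreover $q$ is the best dominant of (1): call an analytic function $r$ in $\mathbb{D}$ a dominant of (1) if $p\prec r$ for every $p\in\mathcal{R}(\alpha,\beta,\gamma,\delta,\mu)$ satisfying (1); then $q$ is a univalent dominant, and $q\prec r$ for every dominant $r$. -/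

import Mathlib

/-- The open unit disk of the complex plane. -/
abbrev unitDisk : Set ℂ := Metric.ball (0 : ℂ) 1

/-- `f` is analytic in the open unit disk. Only the values of `f` in the disk matter. -/
def AnalyticDisk (f : ℂ → ℂ) : Prop := AnalyticOnNhd ℂ f unitDisk

/-- `f` is univalent in the open unit disk: analytic and injective there. -/
def UnivalentDisk (f : ℂ → ℂ) : Prop := AnalyticDisk f ∧ Set.InjOn f unitDisk

/-- Subordination `f ≺ g` of analytic functions in the unit disk: there is a Schwarz function `w`
with `f = g ∘ w` in the disk. Both functions are required to be analytic. -/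
def Subordinate (f g : ℂ → ℂ) : Prop :=
  AnalyticDisk f ∧ AnalyticDisk g ∧
    ∃ w : ℂ → ℂ, AnalyticDisk w ∧ w 0 = 0 ∧ (∀ z ∈ unitDisk, ‖w z‖ < 1) ∧
      ∀ z ∈ unitDisk, f z = g (w z)

/-- The expression `p ^ α * (p + δ + z p' / (β p + γ)) ^ μ`, with principal powers. -/
noncomputable def diffExpr (α : ℝ) (β γ δ : ℂ) (μ : ℝ) (p : ℂ → ℂ) (z : ℂ) : ℂ :=
  (p z) ^ (α : ℂ) * (p z + δ + z * deriv p z / (β * p z + γ)) ^ (μ : ℂ)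

/-- The class `R(α, β, γ, δ, μ)`. The last two fields say that
`p ^ α * (p + δ + z p' / (β p + γ)) ^ μ`, with principal powers, is well-defined as an analytic
function in the disk: the denominator has no zero, and no branch cut makes the function jump. -/
structure ClassR (α : ℝ) (β γ δ : ℂ) (μ : ℝ) (p : ℂ → ℂ) : Prop where
  analytic : AnalyticDisk p
  map_zero : p 0 = 1
  ne_zero : ∀ z ∈ unitDisk, p z ≠ 0
  denom_ne_zero : ∀ z ∈ unitDisk, β * p z + γ ≠ 0
  analytic_diffExpr : AnalyticDisk (diffExpr α β γ δ μ p)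

/-- `r` is a dominant of the set `S` of solutions of a differential subordination: an analytic
function to which all solutions are subordinate. -/
def IsDominant (S : Set (ℂ → ℂ)) (r : ℂ → ℂ) : Prop :=
  AnalyticDisk r ∧ ∀ p ∈ S, Subordinate p r

/-- `q` is the best dominant of `S`: a univalent dominant that is subordinate to every
dominant. -/
def IsBestDominant (S : Set (ℂ → ℂ)) (q : ℂ → ℂ) : Prop :=
  UnivalentDisk q ∧ IsDominant S q ∧ ∀ r, IsDominant S r → Subordinate q r

/-- The function `R(z) = z q'(z) / (β q(z) + γ)`. -/
noncomputable def bbTerm (β γ : ℂ) (q : ℂ → ℂ) (z : ℂ) : ℂ :=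
  z * deriv q z / (β * q z + γ)

open ComplexConjugate

/-! Taking `μ`-th roots replaces the expression by `G_p = p ^ a * (p + δ + z p' / (β p + γ))`, with
`a = α / μ` and an analytic branch of `log p`. Near `0` one fixed function turns the principal
powers into `G_p` and `G_q`, so by the identity theorem `G_p = G_q ∘ w` on the whole disk
(`exists_branchExpr_eq_comp`).

Write `e ^ L = q' q ^ a / (β q + γ)` and `k' = e ^ L`. The second assumption on `q` says `Re (1 + z
L') > 0`, so `k` is convex; with the first, `Re (G_q' / k') > 0`, so `G_q` is close-to-convex
relative to `k`. Hence `G_q` on `|x| < |ζ|` omits the ray from `G_q(ζ)` in the direction `ζ k'(ζ)`,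
the outer normal to the `k`-image of the circle (`ne_add_ray_of_closeToConvex`).

If `p` leaves the range of `q`, Jack's lemma gives `|z| < |ζ|` and `m ≥ 1` with `p(z) = q(ζ)` and `z
p'(z) = m ζ q'(ζ)` (`exists_touching_point`). Then `G_p(z) = G_q(ζ) + (m - 1) ζ k'(ζ)` lies on that
ray, yet equals `G_q(w(z))` with `|w(z)| ≤ |z| < |ζ|`, a contradiction. -/

/-! ### Primitives and logarithms in the disk. -/

theorem exists_primitive_unitDisk {f : ℂ → ℂ} (hf : AnalyticDisk f) (c : ℂ) :
    ∃ F : ℂ → ℂ, AnalyticDisk F ∧ F 0 = c ∧ ∀ z ∈ unitDisk, HasDerivAt F (f z) z := by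
  obtain ⟨F, hF⟩ := hf.differentiableOn.isExactOn_ball
  have hF' : ∀ z ∈ unitDisk, HasDerivAt (fun z => F z + (c - F 0)) (f z) z :=
    fun z hz => (hF z hz).add_const _
  refine ⟨fun z => F z + (c - F 0), ?_, by ring, hF'⟩
  exact (Complex.analyticOnNhd_iff_differentiableOn Metric.isOpen_ball).2
    fun z hz => (hF' z hz).differentiableAt.differentiableWithinAt

theorem exists_analytic_log_unitDisk {f : ℂ → ℂ} (hf : AnalyticDisk f)
    (h0 : ∀ z ∈ unitDisk, f z ≠ 0) :
    ∃ L : ℂ → ℂ, AnalyticDisk L ∧ L 0 = Complex.log (f 0) ∧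
      ∀ z ∈ unitDisk, Complex.exp (L z) = f z := by
  obtain ⟨L, hL, hL0, hL'⟩ := exists_primitive_unitDisk
    (f := fun z => deriv f z / f z) (hf.deriv.div hf h0) (Complex.log (f 0))
  refine ⟨L, hL, hL0, fun z hz => ?_⟩
  have h0mem : (0 : ℂ) ∈ unitDisk := Metric.mem_ball_self one_pos
  have hder : ∀ x ∈ unitDisk, HasDerivAt (fun z => f z * Complex.exp (-L z)) 0 x := by
    intro x hx
    have h1 := (hf x hx).differentiableAt.hasDerivAt.mul (hL' x hx).neg.cexp
    refine h1.congr_deriv ?_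
    have := h0 x hx
    simp only [Pi.neg_apply]
    field_simp
    ring
  have hconst := Metric.isOpen_ball.is_const_of_deriv_eq_zero
    (convex_ball (0 : ℂ) 1).isPreconnected
    (fun x hx => (hder x hx).differentiableAt.differentiableWithinAt)
    (fun x hx => (hder x hx).deriv) hz h0mem
  simp only [hL0, Complex.exp_neg, Complex.exp_log (h0 0 h0mem)] at hconst
  rw [mul_inv_cancel₀ (h0 0 h0mem)] at hconst
  have := Complex.exp_ne_zero (L z)
  field_simp at hconst
  exact hconst.symm

/-! ### Inverses of injective analytic functions. -/

section Inverse

variable {f : ℂ → ℂ} {U : Set ℂ}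

theorem image_mem_nhds_of_injOn (hU : IsOpen U) (hf : AnalyticOnNhd ℂ f U) (hi : Set.InjOn f U)
    {z : ℂ} (hz : z ∈ U) {N : Set ℂ} (hN : N ∈ nhds z) : f '' N ∈ nhds (f z) := by
  rcases (hf z hz).eventually_constant_or_nhds_le_map_nhds with h | h
  · exfalso
    have h1 : ∀ᶠ x in nhds z, x = z := by
      filter_upwards [h, hU.mem_nhds hz] with x hx hxU using hi hxU hz hx
    have h2 : ∀ᶠ x in nhdsWithin z {z}ᶜ, x = z := h1.filter_mono nhdsWithin_le_nhds
    obtain ⟨x, hx, hx'⟩ := (h2.and self_mem_nhdsWithin).exists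
    exact hx' hx
  · exact h (Filter.image_mem_map hN)

theorem continuousAt_invFunOn (hU : IsOpen U) (hf : AnalyticOnNhd ℂ f U) (hi : Set.InjOn f U)
    {z : ℂ} (hz : z ∈ U) : ContinuousAt (Function.invFunOn f U) (f z) := by
  intro N hN
  rw [hi.leftInvOn_invFunOn hz] at hN
  rw [Filter.mem_map]
  filter_upwards [image_mem_nhds_of_injOn hU hf hi hz (Filter.inter_mem hN (hU.mem_nhds hz))]
  rintro _ ⟨x, ⟨hxN, hxU⟩, rfl⟩
  show Function.invFunOn f U (f x) ∈ N
  rwa [hi.leftInvOn_invFunOn hxU]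

theorem hasDerivAt_invFunOn_of_deriv_ne_zero (hU : IsOpen U) (hf : AnalyticOnNhd ℂ f U)
    (hi : Set.InjOn f U) {z : ℂ} (hz : z ∈ U) (hd : deriv f z ≠ 0) :
    HasDerivAt (Function.invFunOn f U) (deriv f z)⁻¹ (f z) := by
  have hz' := hi.leftInvOn_invFunOn hz
  refine HasDerivAt.of_local_left_inverse (f := f) (continuousAt_invFunOn hU hf hi hz) ?_ hd ?_
  · rw [hz']
    exact (hf z hz).differentiableAt.hasDerivAt
  · filter_upwards [image_mem_nhds_of_injOn hU hf hi hz (hU.mem_nhds hz)]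
    rintro _ ⟨x, hx, rfl⟩
    rw [hi.leftInvOn_invFunOn hx]

/-- A zero of `f'` is isolated, as `f` is not locally constant. The inverse is then differentiable
on a punctured neighbourhood of `f z` and continuous at `f z`, so the singularity is removable, and
the chain rule at `z` forbids `f' = 0`. -/
theorem deriv_ne_zero_of_injOn (hU : IsOpen U) (hf : AnalyticOnNhd ℂ f U)
    (hi : Set.InjOn f U) {z : ℂ} (hz : z ∈ U) : deriv f z ≠ 0 := by
  rcases (hf.deriv z hz).eventually_eq_zero_or_eventually_ne_zero with h | h
  · exfalso
    obtain ⟨r, hr, hball⟩ := Metric.eventually_nhds_iff_ball.1 (h.and (hU.mem_nhds hz))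
    have hw : z + (r / 2 : ℝ) ∈ Metric.ball z r := by
      simp [abs_of_pos hr]; linarith
    have hzb : z ∈ Metric.ball z r := Metric.mem_ball_self hr
    have heq := Metric.isOpen_ball.is_const_of_deriv_eq_zero (convex_ball z r).isPreconnected
      (fun x hx => (hf x (hball x hx).2).differentiableAt.differentiableWithinAt)
      (fun x hx => (hball x hx).1) hw hzb
    have := hi (hball _ hw).2 hz heq
    simp at this
    linarith
  · have hzinv := hi.leftInvOn_invFunOn hz
    have hg : AnalyticAt ℂ (Function.invFunOn f U) (f z) := by
      refine Complex.analyticAt_of_differentiable_on_punctured_nhds_of_continuousAt ?_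
        (continuousAt_invFunOn hU hf hi hz)
      rw [eventually_nhdsWithin_iff] at h ⊢
      filter_upwards [image_mem_nhds_of_injOn hU hf hi hz (Filter.inter_mem h (hU.mem_nhds hz))]
      rintro _ ⟨x, ⟨hx, hxU⟩, rfl⟩ hne
      refine (hasDerivAt_invFunOn_of_deriv_ne_zero hU hf hi hxU (hx ?_)).differentiableAt
      rintro rfl
      exact hne rfl
    intro h0
    have h1 := hg.differentiableAt.hasDerivAt.comp z (hf z hz).differentiableAt.hasDerivAt
    rw [h0, mul_zero] at h1
    have h2 : HasDerivAt (Function.invFunOn f U ∘ f) 1 z := by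
      refine (hasDerivAt_id z).congr_of_eventuallyEq ?_
      filter_upwards [hU.mem_nhds hz] with x hx using hi.leftInvOn_invFunOn hx
    exact one_ne_zero (h2.unique h1)

theorem hasDerivAt_invFunOn (hU : IsOpen U) (hf : AnalyticOnNhd ℂ f U)
    (hi : Set.InjOn f U) {z : ℂ} (hz : z ∈ U) :
    HasDerivAt (Function.invFunOn f U) (deriv f z)⁻¹ (f z) :=
  hasDerivAt_invFunOn_of_deriv_ne_zero hU hf hi hz (deriv_ne_zero_of_injOn hU hf hi hz)

theorem isOpen_image_of_injOn (hU : IsOpen U) (hf : AnalyticOnNhd ℂ f U)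
    (hi : Set.InjOn f U) {V : Set ℂ} (hVU : V ⊆ U) (hV : IsOpen V) : IsOpen (f '' V) := by
  rw [isOpen_iff_mem_nhds]
  rintro _ ⟨z, hz, rfl⟩
  exact image_mem_nhds_of_injOn hU hf hi (hVU hz) (hV.mem_nhds hz)

theorem analyticOnNhd_invFunOn (hU : IsOpen U) (hf : AnalyticOnNhd ℂ f U) (hi : Set.InjOn f U) :
    AnalyticOnNhd ℂ (Function.invFunOn f U) (f '' U) := by
  rw [Complex.analyticOnNhd_iff_differentiableOn (isOpen_image_of_injOn hU hf hi subset_rfl hU)]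
  rintro _ ⟨z, hz, rfl⟩
  exact (hasDerivAt_invFunOn hU hf hi hz).differentiableAt.differentiableWithinAt

end Inverse

/-! ### Convex and close-to-convex functions. -/

section Convex

variable {k L : ℂ → ℂ}

/-- On the circle through `ζ`, the argument `θ + Im L(ζ e^{iθ})` of `z e^{L z}` is strictly
increasing. -/
theorem strictMono_arg_on_circle (hL : AnalyticDisk L)
    (hre : ∀ z ∈ unitDisk, 0 < (1 + z * deriv L z).re) {ζ : ℂ} (hζ : ζ ∈ unitDisk) :
    Continuous (fun θ : ℝ => θ + (L (ζ * Complex.exp (θ * Complex.I))).im) ∧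
    StrictMono (fun θ : ℝ => θ + (L (ζ * Complex.exp (θ * Complex.I))).im) := by
  have hmem : ∀ θ : ℝ, ζ * Complex.exp (θ * Complex.I) ∈ unitDisk := by
    intro θ
    simpa [Complex.norm_exp_ofReal_mul_I] using hζ
  have hder : ∀ θ : ℝ, HasDerivAt (fun θ : ℝ => θ + (L (ζ * Complex.exp (θ * Complex.I))).im)
      ((1 + (ζ * Complex.exp (θ * Complex.I)) *
        deriv L (ζ * Complex.exp (θ * Complex.I))).re) θ := by
    intro θ
    have h1 : HasDerivAt (fun t : ℂ => ζ * Complex.exp (t * Complex.I))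
        (ζ * (Complex.exp (θ * Complex.I) * (1 * Complex.I))) (θ : ℂ) :=
      (((hasDerivAt_id (θ : ℂ)).mul_const Complex.I).cexp).const_mul ζ
    have h2 := ((hL _ (hmem θ)).differentiableAt.hasDerivAt.comp (θ : ℂ) h1).comp_ofReal
    have h3 := Complex.imCLM.hasFDerivAt.comp_hasDerivAt θ h2
    have h4 := (hasDerivAt_id θ).add h3
    refine h4.congr_deriv ?_
    simp only [Complex.imCLM_apply, Complex.add_re, Complex.one_re]
    rw [show deriv L (ζ * Complex.exp (θ * Complex.I)) *
      (ζ * (Complex.exp (θ * Complex.I) * (1 * Complex.I))) =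
      Complex.I * (ζ * Complex.exp (θ * Complex.I) * deriv L (ζ * Complex.exp (θ * Complex.I)))
      by ring, Complex.I_mul_im]
  refine ⟨continuous_iff_continuousAt.2 fun θ => (hder θ).continuousAt,
    strictMono_of_deriv_pos fun θ => ?_⟩
  rw [(hder θ).deriv]
  exact hre _ (hmem θ)

/-- The vector `ζ e ^ (L ζ)` is normal to the image curve at `k ζ`. The tangent turns monotonically
through `2π` in one circuit, so the height along this normal first falls, then rises, and vanishes
at both ends. -/
theorem re_sub_mul_conj_neg_on_circle (hL : AnalyticDisk L)
    (hk : ∀ z ∈ unitDisk, HasDerivAt k (Complex.exp (L z)) z)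
    (hre : ∀ z ∈ unitDisk, 0 < (1 + z * deriv L z).re) {ζ : ℂ} (hζ : ζ ∈ unitDisk) (hζ0 : ζ ≠ 0)
    {θ : ℝ} (hθ0 : 0 < θ) (hθ1 : θ < 2 * Real.pi) :
    ((k (ζ * Complex.exp (θ * Complex.I)) - k ζ) * conj (ζ * Complex.exp (L ζ))).re < 0 := by
  obtain ⟨hψc, hψm⟩ := strictMono_arg_on_circle hL hre hζ
  set ψ : ℝ → ℝ := fun θ : ℝ => θ + (L (ζ * Complex.exp (θ * Complex.I))).im with hψ
  have hmem : ∀ θ : ℝ, ζ * Complex.exp (θ * Complex.I) ∈ unitDisk := by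
    intro θ
    simpa [Complex.norm_exp_ofReal_mul_I] using hζ
  set g : ℝ → ℝ := fun θ =>
    ((k (ζ * Complex.exp (θ * Complex.I)) - k ζ) * conj (ζ * Complex.exp (L ζ))).re with hg
  have hder : ∀ θ : ℝ, HasDerivAt g
      (-(‖ζ‖ ^ 2 * Real.exp ((L (ζ * Complex.exp (θ * Complex.I))).re + (L ζ).re) *
        Real.sin (ψ θ - (L ζ).im))) θ := by
    intro θ
    have h1 : HasDerivAt (fun t : ℂ => ζ * Complex.exp (t * Complex.I))
        (ζ * (Complex.exp (θ * Complex.I) * (1 * Complex.I))) (θ : ℂ) :=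
      (((hasDerivAt_id (θ : ℂ)).mul_const Complex.I).cexp).const_mul ζ
    have h2 := ((((hk _ (hmem θ)).comp (θ : ℂ) h1).sub_const (k ζ)).mul_const
      (conj (ζ * Complex.exp (L ζ)))).comp_ofReal
    have h3 := Complex.reCLM.hasFDerivAt.comp_hasDerivAt θ h2
    refine h3.congr_deriv ?_
    simp only [Complex.reCLM_apply]
    have e1 : Complex.exp (L (ζ * Complex.exp (θ * Complex.I))) *
        (ζ * (Complex.exp (θ * Complex.I) * (1 * Complex.I))) * conj (ζ * Complex.exp (L ζ)) =
        ((‖ζ‖ ^ 2 : ℝ) : ℂ) * (Complex.I * Complex.exp (L (ζ * Complex.exp (θ * Complex.I))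
          + θ * Complex.I + conj (L ζ))) := by
      rw [map_mul, ← Complex.exp_conj, Complex.exp_add, Complex.exp_add, Complex.ofReal_pow,
        ← Complex.mul_conj']
      ring
    rw [e1, Complex.re_ofReal_mul, Complex.I_mul_re, Complex.exp_im]
    have e2 : (L (ζ * Complex.exp (θ * Complex.I)) + θ * Complex.I + conj (L ζ)).re =
      (L (ζ * Complex.exp (θ * Complex.I))).re + (L ζ).re := by simp
    have e3 : (L (ζ * Complex.exp (θ * Complex.I)) + θ * Complex.I + conj (L ζ)).im =
      ψ θ - (L ζ).im := by simp [hψ]; ring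
    rw [e2, e3]
    ring
  have hζpos : 0 < ‖ζ‖ ^ 2 := by positivity
  have hgc : Continuous g := continuous_iff_continuousAt.2 fun θ => (hder θ).continuousAt
  have hψ0 : ψ 0 = (L ζ).im := by simp [hψ]
  have hψ1 : ψ (2 * Real.pi) = 2 * Real.pi + (L ζ).im := by
    simp [hψ, Complex.exp_two_pi_mul_I]
  have hg0 : g 0 = 0 := by simp [hg]
  have hg1 : g (2 * Real.pi) = 0 := by simp [hg, Complex.exp_two_pi_mul_I]
  -- At `θ₁` the tangent has turned by `π`, where the sine in the derivative of `g` changes sign.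
  obtain ⟨θ₁, hθ₁, hψθ₁⟩ : ∃ θ₁ ∈ Set.Icc 0 (2 * Real.pi), ψ θ₁ = Real.pi + (L ζ).im := by
    apply intermediate_value_Icc (by positivity) hψc.continuousOn
    rw [hψ0, hψ1]
    constructor <;> linarith [Real.pi_pos]
  show g θ < 0
  rcases le_total θ θ₁ with h | h
  · have hanti : StrictAntiOn g (Set.Icc 0 θ₁) := by
      refine strictAntiOn_of_deriv_neg (convex_Icc _ _) hgc.continuousOn fun x hx => ?_
      rw [interior_Icc] at hx
      rw [(hder x).deriv, neg_neg_iff_pos]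
      have h1 := hψm hx.1
      have h2 := hψm hx.2
      have := Real.sin_pos_of_pos_of_lt_pi (x := ψ x - (L ζ).im) (by linarith) (by linarith)
      positivity
    have := hanti ⟨le_rfl, hθ0.le.trans h⟩ ⟨hθ0.le, h⟩ hθ0
    linarith
  · have hmono : StrictMonoOn g (Set.Icc θ₁ (2 * Real.pi)) := by
      refine strictMonoOn_of_deriv_pos (convex_Icc _ _) hgc.continuousOn fun x hx => ?_
      rw [interior_Icc] at hx
      rw [(hder x).deriv]
      have h1 := hψm hx.1
      have h2 := hψm hx.2
      have h3 := Real.sin_pos_of_pos_of_lt_pi (x := ψ x - (L ζ).im - Real.pi)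
        (by linarith) (by linarith)
      rw [Real.sin_sub_pi] at h3
      rw [← mul_neg]
      positivity
    have := hmono ⟨h, hθ1.le⟩ ⟨h.trans hθ1.le, le_rfl⟩ hθ1
    linarith

/-- The image of a disk under `k` lies strictly inside each of its supporting half-planes. -/
theorem re_sub_mul_conj_neg (hL : AnalyticDisk L)
    (hk : ∀ z ∈ unitDisk, HasDerivAt k (Complex.exp (L z)) z)
    (hre : ∀ z ∈ unitDisk, 0 < (1 + z * deriv L z).re) {z ζ : ℂ} (hζ : ζ ∈ unitDisk)
    (hz : ‖z‖ ≤ ‖ζ‖) (hne : z ≠ ζ) :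
    ((k z - k ζ) * conj (ζ * Complex.exp (L ζ))).re < 0 := by
  have hζ0 : ζ ≠ 0 := by
    rintro rfl
    exact hne (by simpa using hz)
  have hζn : 0 < ‖ζ‖ := norm_pos_iff.2 hζ0
  have hζ1 : ‖ζ‖ < 1 := by simpa using hζ
  have hcirc : ∀ x : ℂ, ‖x‖ = ‖ζ‖ → x ≠ ζ →
      ((k x - k ζ) * conj (ζ * Complex.exp (L ζ))).re < 0 := by
    intro x hx hxne
    have hunit : ‖x / ζ‖ = 1 := by rw [norm_div, hx, div_self hζn.ne']
    obtain ⟨θ, hθ, hθx⟩ : ∃ θ : ℝ, θ ∈ Set.Ico 0 (2 * Real.pi) ∧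
        Complex.exp (θ * Complex.I) = x / ζ := by
      have h1 : Complex.exp ((x / ζ).arg * Complex.I) = x / ζ := by
        have := Complex.norm_mul_exp_arg_mul_I (x / ζ)
        rwa [hunit, Complex.ofReal_one, one_mul] at this
      rcases le_or_gt 0 (x / ζ).arg with h | h
      · exact ⟨_, ⟨h, by linarith [Complex.arg_le_pi (x / ζ), Real.pi_pos]⟩, h1⟩
      · refine ⟨(x / ζ).arg + 2 * Real.pi,
          ⟨by linarith [Complex.neg_pi_lt_arg (x / ζ)], by linarith⟩, ?_⟩
        push_cast
        rw [add_mul, Complex.exp_add, Complex.exp_two_pi_mul_I, mul_one, h1]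
    have hxe : ζ * Complex.exp (θ * Complex.I) = x := by
      rw [hθx]; field_simp
    have hθ0 : 0 < θ := by
      refine lt_of_le_of_ne hθ.1 ?_
      rintro rfl
      apply hxne
      rw [← hxe]; simp
    have := re_sub_mul_conj_neg_on_circle hL hk hre hζ hζ0 hθ0 hθ.2
    rwa [hxe] at this
  rcases hz.lt_or_eq with hlt | heq
  swap
  · exact hcirc z heq hne
  -- The exponential turns the real part into a modulus, to which the maximum principle applies.
  set u : ℂ → ℂ := fun x => Complex.exp ((k x - k ζ) * conj (ζ * Complex.exp (L ζ))) with hu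
  have hnorm : ∀ x, ‖u x‖ = Real.exp ((k x - k ζ) * conj (ζ * Complex.exp (L ζ))).re :=
    fun x => Complex.norm_exp _
  have hsub : Metric.closedBall (0 : ℂ) ‖ζ‖ ⊆ unitDisk := Metric.closedBall_subset_ball hζ1
  have hdiff : ∀ x ∈ unitDisk, DifferentiableAt ℂ u x := fun x hx =>
    (((hk x hx).differentiableAt.sub_const _).mul_const _).cexp
  have hdcc : DiffContOnCl ℂ u (Metric.ball 0 ‖ζ‖) := by
    refine DifferentiableOn.diffContOnCl fun x hx => ?_
    rw [closure_ball _ hζn.ne'] at hx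
    exact (hdiff x (hsub hx)).differentiableWithinAt
  have hle : ∀ x ∈ Metric.closedBall (0 : ℂ) ‖ζ‖, ‖u x‖ ≤ 1 := by
    rw [← closure_ball _ hζn.ne']
    intro x hx
    refine Complex.norm_le_of_forall_mem_frontier_norm_le Metric.isBounded_ball hdcc ?_ hx
    intro y hy
    rw [frontier_ball _ hζn.ne', mem_sphere_zero_iff_norm] at hy
    rw [hnorm, Real.exp_le_one_iff]
    by_cases hyζ : y = ζ
    · simp [hyζ]
    · exact (hcirc y hy hyζ).le
  by_contra! hcon
  have hz1 : ‖u z‖ = 1 := by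
    refine le_antisymm (hle z (by simpa using hz)) ?_
    rw [hnorm]
    exact Real.one_le_exp hcon
  have hmax : IsMaxOn (norm ∘ u) (Metric.ball 0 ‖ζ‖) z := by
    intro x hx
    show ‖u x‖ ≤ ‖u z‖
    rw [hz1]
    exact hle x (Metric.ball_subset_closedBall hx)
  have heqOn := Complex.norm_eqOn_closure_of_isPreconnected_of_isMaxOn
    (convex_ball (0 : ℂ) ‖ζ‖).isPreconnected Metric.isOpen_ball hdcc (c := z)
    (by simpa using hlt) hmax
  -- An interior maximum would force `‖u‖ = 1` on the closed disk, but the bound on the circle is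
  -- strict at `-ζ`.
  have hneg : -ζ ∈ closure (Metric.ball (0 : ℂ) ‖ζ‖) := by
    rw [closure_ball _ hζn.ne']; simp
  have h1 := heqOn hneg
  simp only [Function.comp, Function.const, hz1] at h1
  have h2 := hcirc (-ζ) (norm_neg ζ) (by
    intro h
    exact hζ0 (by simpa using (self_eq_neg.1 h.symm)))
  rw [hnorm, Real.exp_eq_one_iff] at h1
  linarith

/-- Of two distinct points, the one of smaller modulus is mapped strictly inside the supporting
half-plane at the image of the other. -/
theorem injOn_of_convex (hL : AnalyticDisk L)
    (hk : ∀ z ∈ unitDisk, HasDerivAt k (Complex.exp (L z)) z)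
    (hre : ∀ z ∈ unitDisk, 0 < (1 + z * deriv L z).re) : Set.InjOn k unitDisk := by
  intro x hx y hy hxy
  by_contra hne
  rcases le_total ‖x‖ ‖y‖ with h | h
  · simpa [hxy] using re_sub_mul_conj_neg hL hk hre hy h hne
  · simpa [hxy] using re_sub_mul_conj_neg hL hk hre hx h (Ne.symm hne)

/-- The segment from an interior point to a boundary point of the image of a disk stays in the
image of the open disk. -/
theorem segment_mem_image_of_convex (hL : AnalyticDisk L)
    (hk : ∀ z ∈ unitDisk, HasDerivAt k (Complex.exp (L z)) z)
    (hre : ∀ z ∈ unitDisk, 0 < (1 + z * deriv L z).re) {z ζ : ℂ} (hζ : ζ ∈ unitDisk)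
    (hz : ‖z‖ < ‖ζ‖) {t : ℝ} (ht : t ∈ Set.Ico (0 : ℝ) 1) :
    k z + t * (k ζ - k z) ∈ k '' Metric.ball 0 ‖ζ‖ := by
  have hζ1 : ‖ζ‖ < 1 := by simpa using hζ
  have hζn : 0 < ‖ζ‖ := (norm_nonneg z).trans_lt hz
  have hsub : Metric.closedBall (0 : ℂ) ‖ζ‖ ⊆ unitDisk := Metric.closedBall_subset_ball hζ1
  have hka : AnalyticOnNhd ℂ k unitDisk :=
    (Complex.analyticOnNhd_iff_differentiableOn Metric.isOpen_ball).2
      fun x hx => (hk x hx).differentiableAt.differentiableWithinAt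
  have hopen : IsOpen (k '' Metric.ball 0 ‖ζ‖) :=
    isOpen_image_of_injOn Metric.isOpen_ball hka (injOn_of_convex hL hk hre)
      (Metric.ball_subset_closedBall.trans hsub) Metric.isOpen_ball
  have hcpt : IsCompact (k '' Metric.closedBall 0 ‖ζ‖) :=
    (isCompact_closedBall _ _).image_of_continuousOn (hka.continuousOn.mono hsub)
  set c : ℝ → ℂ := fun t => k z + t * (k ζ - k z) with hc
  have hcc : Continuous c := by fun_prop
  by_contra hcon
  set T : Set ℝ := Set.Icc 0 t ∩ c ⁻¹' (k '' Metric.ball 0 ‖ζ‖)ᶜ with hT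
  have hTcpt : IsCompact T := isCompact_Icc.inter_right (hopen.isClosed_compl.preimage hcc)
  -- At the first exit time `s` the segment meets the boundary curve at some `k b`. In the
  -- supporting half-plane there `k z` is strictly inside and `k ζ` is not outside, so `k b` cannot
  -- lie between them.
  obtain ⟨s, hsT, hs⟩ := hTcpt.exists_isLeast ⟨t, ⟨ht.1, le_rfl⟩, hcon⟩
  have hs0 : 0 < s := by
    refine lt_of_le_of_ne hsT.1.1 ?_
    rintro rfl
    exact hsT.2 ⟨z, by simpa using hz, by simp [hc]⟩
  have hs1 : s < 1 := hsT.1.2.trans_lt ht.2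
  have hbefore : ∀ x ∈ Set.Ico 0 s, c x ∈ k '' Metric.closedBall 0 ‖ζ‖ := by
    intro x hx
    by_contra hx'
    refine absurd (hs (show x ∈ T from ⟨⟨hx.1, hx.2.le.trans hsT.1.2⟩, fun h => hx' ?_⟩))
      (not_le.2 hx.2)
    exact Set.image_mono Metric.ball_subset_closedBall h
  have hcs : c s ∈ k '' Metric.closedBall 0 ‖ζ‖ := by
    have h1 : s ∈ closure (Set.Ico 0 s) := by
      rw [closure_Ico hs0.ne]; exact ⟨hs0.le, le_rfl⟩
    have h2 := image_closure_subset_closure_image hcc ⟨s, h1, rfl⟩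
    refine hcpt.isClosed.closure_subset_iff.2 ?_ h2
    rintro _ ⟨x, hx, rfl⟩
    exact hbefore x hx
  obtain ⟨b, hb, hbc⟩ := hcs
  have hbn : ‖b‖ = ‖ζ‖ := by
    refine le_antisymm (by simpa using hb) (not_lt.1 fun h => hsT.2 ⟨b, by simpa using h, hbc⟩)
  have h1 := re_sub_mul_conj_neg hL hk hre (hsub hb) (z := z) (by rw [hbn]; exact hz.le)
    (by rintro rfl; exact hz.ne hbn)
  have h2 : ((k ζ - k b) * conj (b * Complex.exp (L b))).re ≤ 0 := by
    by_cases h : ζ = b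
    · simp [h]
    · exact (re_sub_mul_conj_neg hL hk hre (hsub hb) hbn.ge h).le
  have e1 : k z - k b = ((-s : ℝ) : ℂ) * (k ζ - k z) := by
    rw [hbc]; simp only [hc]; push_cast; ring
  have e2 : k ζ - k b = ((1 - s : ℝ) : ℂ) * (k ζ - k z) := by
    rw [hbc]; simp only [hc]; push_cast; ring
  rw [e1, mul_assoc, Complex.re_ofReal_mul] at h1
  rw [e2, mul_assoc, Complex.re_ofReal_mul] at h2
  nlinarith

/-- A close-to-convex function omits, on an open disk, the rays emanating from its boundary values
in the normal directions of the associated convex function. -/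
theorem ne_add_ray_of_closeToConvex {h A : ℂ → ℂ} (hL : AnalyticDisk L)
    (hk : ∀ z ∈ unitDisk, HasDerivAt k (Complex.exp (L z)) z)
    (hre : ∀ z ∈ unitDisk, 0 < (1 + z * deriv L z).re)
    (hh : ∀ z ∈ unitDisk, HasDerivAt h (Complex.exp (L z) * A z) z)
    (hA : ∀ z ∈ unitDisk, 0 < (A z).re) {z ζ : ℂ} (hζ : ζ ∈ unitDisk) (hz : ‖z‖ < ‖ζ‖)
    {t : ℝ} (ht : 0 ≤ t) : h z ≠ h ζ + t * (ζ * Complex.exp (L ζ)) := by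
  intro heq
  have hζ1 : ‖ζ‖ < 1 := by simpa using hζ
  have hzmem : z ∈ unitDisk := by simpa using hz.trans hζ1
  have hka : AnalyticOnNhd ℂ k unitDisk :=
    (Complex.analyticOnNhd_iff_differentiableOn Metric.isOpen_ball).2
      fun x hx => (hk x hx).differentiableAt.differentiableWithinAt
  have hki := injOn_of_convex hL hk hre
  have hsup := re_sub_mul_conj_neg hL hk hre hζ hz.le (by rintro rfl; exact hz.ne rfl)
  set d : ℂ := k ζ - k z with hd
  have hd0 : d ≠ 0 := by
    intro h0
    rw [← neg_sub, ← hd, h0] at hsup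
    simp at hsup
  set c : ℝ → ℂ := fun t => k z + t * d with hc
  have hcmem : ∀ x ∈ Set.Icc (0 : ℝ) 1, ∃ y ∈ unitDisk, k y = c x := by
    intro x hx
    rcases hx.2.lt_or_eq with h1 | rfl
    · obtain ⟨y, hy, hyc⟩ := segment_mem_image_of_convex hL hk hre hζ hz ⟨hx.1, h1⟩
      exact ⟨y, Metric.ball_subset_ball hζ1.le hy, hyc⟩
    · exact ⟨ζ, hζ, by simp [hc, hd]⟩
  have hder : ∀ x ∈ Set.Icc (0 : ℝ) 1, ∃ y ∈ unitDisk,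
      HasDerivAt (fun x : ℝ => (h (Function.invFunOn k unitDisk (c x)) / d).re) ((A y).re) x := by
    intro x hx
    obtain ⟨y, hy, hyc⟩ := hcmem x hx
    refine ⟨y, hy, ?_⟩
    have h1 : HasDerivAt (fun t : ℂ => k z + t * d) d (x : ℂ) := by
      simpa using ((hasDerivAt_id (x : ℂ)).mul_const d).const_add (k z)
    have h2 := hasDerivAt_invFunOn Metric.isOpen_ball hka hki hy
    have h3 := hh y hy
    rw [(hk y hy).deriv] at h2
    rw [← hki.leftInvOn_invFunOn hy] at h3
    have h4 := h3.comp (k y) h2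
    rw [hyc] at h4
    have h5 := ((h4.comp (x : ℂ) h1).div_const d).comp_ofReal
    have h6 := Complex.reCLM.hasFDerivAt.comp_hasDerivAt x h5
    refine h6.congr_deriv ?_
    rw [← hyc, hki.leftInvOn_invFunOn hy, Complex.reCLM_apply]
    congr 1
    have := Complex.exp_ne_zero (L y)
    field_simp
  -- Along the segment, `h ∘ k⁻¹` has derivative `A d`; dividing by `d` leaves `Re A > 0`.
  have hmono : StrictMonoOn (fun x : ℝ => (h (Function.invFunOn k unitDisk (c x)) / d).re)
      (Set.Icc 0 1) := by
    refine strictMonoOn_of_deriv_pos (convex_Icc _ _) (fun x hx => ?_) fun x hx => ?_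
    · obtain ⟨y, -, hy⟩ := hder x hx
      exact hy.continuousAt.continuousWithinAt
    · obtain ⟨y, hy, hy'⟩ := hder x (interior_subset hx)
      rw [hy'.deriv]
      exact hA y hy
  have hlt := hmono ⟨le_rfl, zero_le_one⟩ ⟨zero_le_one, le_rfl⟩ zero_lt_one
  have c0 : c 0 = k z := by simp [hc]
  have c1 : c 1 = k ζ := by simp [hc, hd]
  simp only [c0, c1, hki.leftInvOn_invFunOn hζ, hki.leftInvOn_invFunOn hzmem] at hlt
  generalize ζ * Complex.exp (L ζ) = n at hsup heq
  rw [heq, add_div, Complex.add_re, mul_div_assoc, Complex.re_ofReal_mul] at hlt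
  have hsup' : 0 < (d * conj n).re := by
    rw [← neg_sub, ← hd, neg_mul, Complex.neg_re] at hsup
    linarith
  have hnd : 0 ≤ (n / d).re := by
    have e : (n / d).re = (d * conj n).re / Complex.normSq d := by
      rw [Complex.div_re, Complex.mul_re, Complex.conj_re, Complex.conj_im]
      ring
    rw [e]
    exact div_nonneg hsup'.le (Complex.normSq_nonneg d)
  have := mul_nonneg ht hnd
  linarith

end Convex

/-! ### Jack's lemma and the touching point. -/

theorem deriv_nonpos_of_forall_le {e : ℝ → ℝ} {e' : ℝ} (he : HasDerivAt e e' 0)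
    (hle : ∀ x, 0 < x → e x ≤ e 0) : e' ≤ 0 := by
  have h1 := (hasDerivWithinAt_iff_tendsto_slope' (s := Set.Ioi 0) (by simp)).1
    (he.hasDerivWithinAt (s := Set.Ioi 0))
  refine le_of_tendsto h1 ?_
  filter_upwards [self_mem_nhdsWithin] with x hx
  have hx' : (0 : ℝ) < x := hx
  rw [slope_def_field]
  exact div_nonpos_of_nonpos_of_nonneg (by linarith [hle x hx']) (by linarith)

/-- **Jack's lemma.** -/
theorem exists_mul_deriv_eq_of_norm_le {v : ℂ → ℂ} {z₀ V : ℂ} {C : ℝ} (hv : HasDerivAt v V z₀)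
    (hle : ∀ z, ‖z‖ ≤ ‖z₀‖ → ‖v z‖ ≤ C * ‖z‖) (heq : ‖v z₀‖ = C * ‖z₀‖) (h0 : v z₀ ≠ 0) :
    ∃ m : ℝ, 1 ≤ m ∧ z₀ * V = m * v z₀ := by
  -- Differentiate the growth bound along `x ↦ z₀ e ^ (x d)`, which stays in the disk. The rotations
  -- `d = ±i` make `z₀ V / v z₀` real; the inward direction `d = -1` makes it at least `1`.
  have key : ∀ d : ℂ, d.re ≤ 0 → (d * (z₀ * V * conj (v z₀))).re ≤ ‖v z₀‖ ^ 2 * d.re := by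
    intro d hd
    have h1 : HasDerivAt (fun t : ℂ => z₀ * Complex.exp (t * d)) (z₀ * d) ((0 : ℝ) : ℂ) := by
      simpa using (((hasDerivAt_id ((0 : ℝ) : ℂ)).mul_const d).cexp).const_mul z₀
    have hv' : HasDerivAt v V (z₀ * Complex.exp (((0 : ℝ) : ℂ) * d)) := by simpa using hv
    have h2 := ((hv'.comp ((0 : ℝ) : ℂ) h1).mul_const (conj (v z₀))).comp_ofReal
    have h3 := Complex.reCLM.hasFDerivAt.comp_hasDerivAt (0 : ℝ) h2
    have h4 : HasDerivAt (fun x : ℝ => ‖v z₀‖ ^ 2 * Real.exp (x * d.re))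
        (‖v z₀‖ ^ 2 * d.re) 0 := by
      simpa using (((hasDerivAt_id (0 : ℝ)).mul_const d.re).exp).const_mul (‖v z₀‖ ^ 2)
    have h5 := deriv_nonpos_of_forall_le (h3.sub h4) ?_
    · simp only [Complex.reCLM_apply] at h5
      rw [show V * (z₀ * d) * conj (v z₀) = d * (z₀ * V * conj (v z₀)) by ring] at h5
      linarith
    · intro x hx
      have e0 : (v z₀ * conj (v z₀)).re = ‖v z₀‖ ^ 2 := by
        rw [Complex.mul_conj, Complex.ofReal_re, Complex.normSq_eq_norm_sq]
      have hn : ‖z₀ * Complex.exp (x * d)‖ = ‖z₀‖ * Real.exp (x * d.re) := by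
        rw [norm_mul, Complex.norm_exp, Complex.re_ofReal_mul]
      have h6 : ‖v (z₀ * Complex.exp (x * d))‖ ≤ ‖v z₀‖ * Real.exp (x * d.re) := by
        refine (hle _ ?_).trans_eq (by rw [hn, heq]; ring)
        rw [hn]
        exact mul_le_of_le_one_right (norm_nonneg _)
          (Real.exp_le_one_iff.2 (mul_nonpos_of_nonneg_of_nonpos hx.le hd))
      have h7 : (v (z₀ * Complex.exp (x * d)) * conj (v z₀)).re ≤
          ‖v z₀‖ ^ 2 * Real.exp (x * d.re) := by
        refine (Complex.re_le_norm _).trans ?_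
        rw [norm_mul, RCLike.norm_conj]
        nlinarith [norm_nonneg (v z₀)]
      simpa [e0] using h7
  have k1 := key Complex.I (by simp)
  have k2 := key (-Complex.I) (by simp)
  have k3 := key (-1) (by simp)
  generalize hW : z₀ * V * conj (v z₀) = W at k1 k2 k3
  simp at k1 k2 k3
  have him : W.im = 0 := le_antisymm k2 k1
  have hpos : 0 < ‖v z₀‖ ^ 2 := by positivity
  refine ⟨W.re / ‖v z₀‖ ^ 2, (one_le_div hpos).2 (by linarith), ?_⟩
  have hWre : ((W.re : ℝ) : ℂ) = W := Complex.ext rfl (by simp [him])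
  have hc : conj (v z₀) ≠ 0 := by simpa using h0
  rw [Complex.ofReal_div, hWre, Complex.ofReal_pow, ← Complex.mul_conj', ← hW]
  field_simp

/-- If `p` leaves the range of a univalent `q`, then on some circle it first touches the image of a
larger circle, with proportional normal derivatives. -/
theorem exists_touching_point {p q : ℂ → ℂ} (hq : UnivalentDisk q) (hp : AnalyticDisk p)
    (h0 : p 0 = q 0) {z₁ : ℂ} (hz₁ : z₁ ∈ unitDisk) (hpz₁ : p z₁ ∉ q '' unitDisk) :
    ∃ (z ζ : ℂ) (v : ℂ → ℂ) (m : ℝ), ζ ∈ unitDisk ∧ ‖z‖ < ‖ζ‖ ∧ 1 ≤ m ∧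
      z * deriv p z = m * (ζ * deriv q ζ) ∧ AnalyticOnNhd ℂ v (Metric.closedBall 0 ‖z‖) ∧
      Set.MapsTo v (Metric.closedBall 0 ‖z‖) unitDisk ∧ v 0 = 0 ∧ v z = ζ ∧
      ∀ x ∈ Metric.closedBall 0 ‖z‖, q (v x) = p x := by
  obtain ⟨hqa, hqi⟩ := hq
  have hz₁n : ‖z₁‖ < 1 := by simpa using hz₁
  -- Since `ρ > |z₁|`, the touching point satisfies `|z| ≤ |z₁| < ρ = |ζ|`; working inside radius
  -- `ρ` avoids the boundary behaviour of `q`.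
  obtain ⟨ρ, hzρ, hρ1⟩ := exists_between hz₁n
  have hρ0 : 0 < ρ := (norm_nonneg _).trans_lt hzρ
  have hsub : Metric.closedBall (0 : ℂ) ρ ⊆ unitDisk := Metric.closedBall_subset_ball hρ1
  have hopen : IsOpen (q '' Metric.ball 0 ρ) :=
    isOpen_image_of_injOn Metric.isOpen_ball hqa hqi
      (Metric.ball_subset_closedBall.trans hsub) Metric.isOpen_ball
  have hcpt : IsCompact (q '' Metric.closedBall 0 ρ) :=
    (isCompact_closedBall _ _).image_of_continuousOn (hqa.continuousOn.mono hsub)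
  have hclosed : IsClosed (Metric.closedBall (0 : ℂ) ‖z₁‖ ∩ p ⁻¹' (q '' Metric.ball 0 ρ)ᶜ) :=
    (hp.continuousOn.mono (Metric.closedBall_subset_ball hz₁n)).preimage_isClosed_of_isClosed
      Metric.isClosed_closedBall hopen.isClosed_compl
  have hScpt : IsCompact (Metric.closedBall (0 : ℂ) ‖z₁‖ ∩ p ⁻¹' (q '' Metric.ball 0 ρ)ᶜ) :=
    (isCompact_closedBall (0 : ℂ) ‖z₁‖).of_isClosed_subset hclosed Set.inter_subset_left
  obtain ⟨z, ⟨hz, hpz⟩, hmin⟩ := hScpt.exists_isMinOn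
    ⟨z₁, by simp, fun h => hpz₁ (Set.image_mono (Metric.ball_subset_closedBall.trans hsub) h)⟩
    continuous_norm.continuousOn
  have hzz₁ : ‖z‖ ≤ ‖z₁‖ := by simpa using hz
  have hzn : ‖z‖ < 1 := hzz₁.trans_lt hz₁n
  have hsubz : Metric.closedBall (0 : ℂ) ‖z‖ ⊆ unitDisk := Metric.closedBall_subset_ball hzn
  have hz0 : z ≠ 0 := by
    rintro rfl
    exact hpz ⟨0, by simpa using hρ0, h0.symm⟩
  have hzpos : 0 < ‖z‖ := norm_pos_iff.2 hz0
  have hin : ∀ x ∈ Metric.ball (0 : ℂ) ‖z‖, p x ∈ q '' Metric.ball 0 ρ := by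
    intro x hx
    by_contra hcon
    have hx' : ‖x‖ < ‖z‖ := by simpa using hx
    exact absurd (hmin (show x ∈ _ from ⟨by simpa using hx'.le.trans hzz₁, hcon⟩)) (not_le.2 hx')
  have hcl : ∀ x ∈ Metric.closedBall (0 : ℂ) ‖z‖, p x ∈ q '' Metric.closedBall 0 ρ := by
    intro x hx
    rw [← closure_ball _ hzpos.ne'] at hx
    have h1 := (hp.continuousOn.mono (by rwa [closure_ball _ hzpos.ne'])).image_closure
      (s := Metric.ball (0 : ℂ) ‖z‖) ⟨x, hx, rfl⟩
    refine hcpt.isClosed.closure_subset_iff.2 ?_ h1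
    rintro _ ⟨y, hy, rfl⟩
    exact Set.image_mono Metric.ball_subset_closedBall (hin y hy)
  set v : ℂ → ℂ := fun x => Function.invFunOn q unitDisk (p x) with hv
  have hvle : ∀ x ∈ Metric.closedBall (0 : ℂ) ‖z‖, v x ∈ Metric.closedBall 0 ρ ∧ q (v x) = p x := by
    intro x hx
    obtain ⟨y, hy, hyx⟩ := hcl x hx
    simp only [hv, ← hyx, hqi.leftInvOn_invFunOn (hsub hy)]
    exact ⟨hy, trivial⟩
  have hva : AnalyticOnNhd ℂ v (Metric.closedBall 0 ‖z‖) := fun x hx =>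
    (analyticOnNhd_invFunOn Metric.isOpen_ball hqa hqi (p x)
      (Set.image_mono hsub (hcl x hx))).comp (hp x (hsubz hx))
  have hzmem : z ∈ Metric.closedBall (0 : ℂ) ‖z‖ := by simp
  have hv0 : v 0 = 0 := by
    simp only [hv, h0]
    exact hqi.leftInvOn_invFunOn (Metric.mem_ball_self one_pos)
  have hvz : ‖v z‖ = ρ := by
    refine le_antisymm (by simpa using (hvle z hzmem).1) (not_lt.1 fun h => hpz ?_)
    exact ⟨v z, by simpa using h, (hvle z hzmem).2⟩
  have hvzD : v z ∈ unitDisk := hsub (hvle z hzmem).1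
  have hvd : HasDerivAt v ((deriv q (v z))⁻¹ * deriv p z) z := by
    have h1 := hasDerivAt_invFunOn Metric.isOpen_ball hqa hqi hvzD
    rw [(hvle z hzmem).2] at h1
    exact h1.comp z (hp z (hsubz hzmem)).differentiableAt.hasDerivAt
  have hSchwarz : ∀ x, ‖x‖ ≤ ‖z‖ → ‖v x‖ ≤ ρ / ‖z‖ * ‖x‖ := by
    intro x hx
    rcases hx.lt_or_eq with hlt | heq
    · have h1 := Complex.dist_le_div_mul_dist_of_mapsTo_ball (f := v) (c := 0) (R₁ := ‖z‖)
        (R₂ := ρ) (z := x)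
        (hva.differentiableOn.mono Metric.ball_subset_closedBall)
        (fun y hy => by rw [hv0]; exact (hvle y (Metric.ball_subset_closedBall hy)).1)
        (by simpa using hlt)
      simpa [hv0] using h1
    · rw [heq, div_mul_cancel₀ _ hzpos.ne']
      simpa using (hvle x (by simpa using hx)).1
  obtain ⟨m, hm, hmeq⟩ := exists_mul_deriv_eq_of_norm_le hvd hSchwarz
    (by rw [hvz, div_mul_cancel₀ _ hzpos.ne']) (by rw [← norm_pos_iff, hvz]; exact hρ0)
  refine ⟨z, v z, v, m, hvzD, by rw [hvz]; exact hzz₁.trans_lt hzρ, hm, ?_, hva,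
    fun x hx => hsub (hvle x hx).1, hv0, rfl, fun x hx => (hvle x hx).2⟩
  have hq' := deriv_ne_zero_of_injOn Metric.isOpen_ball hqa hqi hvzD
  rw [← mul_assoc, ← hmeq]
  field_simp

theorem subordinate_of_image_subset {p q : ℂ → ℂ} (hq : UnivalentDisk q) (hp : AnalyticDisk p)
    (h0 : p 0 = q 0) (hsub : ∀ z ∈ unitDisk, p z ∈ q '' unitDisk) : Subordinate p q := by
  refine ⟨hp, hq.1, fun z => Function.invFunOn q unitDisk (p z), fun z hz => ?_, ?_, fun z hz => ?_,
    fun z hz => (Function.invFunOn_eq (hsub z hz)).symm⟩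
  · exact (analyticOnNhd_invFunOn Metric.isOpen_ball hq.1 hq.2 _ (hsub z hz)).comp (hp z hz)
  · simp only [h0]
    exact hq.2.leftInvOn_invFunOn (Metric.mem_ball_self one_pos)
  · simpa using Function.invFunOn_mem (hsub z hz)

/-! ### From principal powers to analytic branches. -/

section Branch

/-- The expression `p ^ a * (p + δ + z p' / (β p + γ))`, with `lam` as the branch of `log p`. -/
noncomputable def branchExpr (a β γ δ : ℂ) (lam p : ℂ → ℂ) (z : ℂ) : ℂ :=
  Complex.exp (a * lam z) * (p z + δ + z * deriv p z / (β * p z + γ))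

theorem eventually_abs_im_lt {lam : ℂ → ℂ} (hlam : ContinuousAt lam 0) (h0 : lam 0 = 0) (c : ℝ)
    {ε : ℝ} (hε : 0 < ε) : ∀ᶠ z in nhds 0, |c * (lam z).im| < ε := by
  have h1 : ContinuousAt (fun z => |c * (lam z).im|) 0 :=
    ((Complex.continuous_im.continuousAt.comp hlam).const_mul c).abs
  exact h1.eventually_lt continuousAt_const (by simpa [h0] using hε)

theorem log_exp_of_abs_im_lt {x : ℂ} (hx : |x.im| < Real.pi) :
    Complex.log (Complex.exp x) = x :=
  Complex.log_exp (abs_lt.1 hx).1 (abs_lt.1 hx).2.le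

/-- Near the origin, `branchExpr` is a fixed function of `diffExpr`. -/
theorem exists_eventually_branchExpr_eq {α μ : ℝ} (hμ0 : 0 < μ) (hμ1 : μ ≤ 1) (β γ δ : ℂ) :
    ∃ Ψ : ℂ → ℂ, ∀ p lam : ℂ → ℂ, AnalyticDisk lam → lam 0 = 0 →
      (∀ z ∈ unitDisk, Complex.exp (lam z) = p z) →
      ∀ᶠ z in nhds 0, branchExpr ((α : ℂ) / μ) β γ δ lam p z = Ψ (diffExpr α β γ δ μ p z) := by
  have hD : unitDisk ∈ nhds (0 : ℂ) := Metric.ball_mem_nhds _ one_pos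
  -- For `μ < 1` the room `(1 - μ) π` absorbs `α Im (lam z)` near `0`, so the total argument stays
  -- below `π` even when `arg P = π`. For `μ = 1` there is no such room, but also no root to take.
  rcases hμ1.lt_or_eq with hlt | rfl
  · refine ⟨fun x => x ^ (1 / (μ : ℂ)), fun p lam hlam h0 hexp => ?_⟩
    have hμc : (μ : ℂ) ≠ 0 := by exact_mod_cast hμ0.ne'
    have hc := (hlam 0 (mem_of_mem_nhds hD)).continuousAt
    filter_upwards [hD, eventually_abs_im_lt hc h0 1 Real.pi_pos,
      eventually_abs_im_lt hc h0 α (mul_pos (sub_pos.2 hlt) Real.pi_pos)] with z hz h1 h2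
    rw [one_mul] at h1
    simp only [branchExpr, diffExpr]
    generalize p z + δ + z * deriv p z / (β * p z + γ) = P
    rw [← hexp z hz]
    rcases eq_or_ne P 0 with rfl | hP
    · simp [hμc]
    · have hF : Complex.exp (lam z) ^ (α : ℂ) * P ^ (μ : ℂ) =
          Complex.exp (α * lam z + μ * Complex.log P) := by
        rw [Complex.cpow_def_of_ne_zero (Complex.exp_ne_zero _), Complex.cpow_def_of_ne_zero hP,
          log_exp_of_abs_im_lt h1, ← Complex.exp_add]
        ring_nf
      have him : |(α * lam z + μ * Complex.log P).im| < Real.pi := by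
        rw [Complex.add_im, Complex.im_ofReal_mul, Complex.im_ofReal_mul]
        have h3 := Complex.abs_arg_le_pi P
        rw [← Complex.log_im] at h3
        calc _ ≤ |α * (lam z).im| + |μ * (Complex.log P).im| := abs_add_le _ _
          _ < (1 - μ) * Real.pi + μ * Real.pi := by
            refine add_lt_add_of_lt_of_le h2 ?_
            rw [abs_mul, abs_of_pos hμ0]
            exact mul_le_mul_of_nonneg_left h3 hμ0.le
          _ = Real.pi := by ring
      rw [hF, Complex.cpow_def_of_ne_zero (Complex.exp_ne_zero _), log_exp_of_abs_im_lt him]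
      nth_rewrite 1 [← Complex.exp_log hP]
      rw [← Complex.exp_add]
      congr 1
      field_simp
  · refine ⟨id, fun p lam hlam h0 hexp => ?_⟩
    have hc := (hlam 0 (mem_of_mem_nhds hD)).continuousAt
    filter_upwards [hD, eventually_abs_im_lt hc h0 1 Real.pi_pos] with z hz h1
    rw [one_mul] at h1
    simp only [branchExpr, diffExpr, id]
    rw [← hexp z hz, Complex.cpow_def_of_ne_zero (Complex.exp_ne_zero _), log_exp_of_abs_im_lt h1]
    simp [mul_comm]

theorem analyticDisk_branchExpr {a β γ δ : ℂ} {lam p : ℂ → ℂ} (hlam : AnalyticDisk lam)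
    (hp : AnalyticDisk p) (hden : ∀ z ∈ unitDisk, β * p z + γ ≠ 0) :
    AnalyticDisk (branchExpr a β γ δ lam p) := fun z hz =>
  (analyticAt_const.mul (hlam z hz)).cexp.mul
    (((hp z hz).add analyticAt_const).add
      ((analyticAt_id.mul (hp z hz).deriv).div
        ((analyticAt_const.mul (hp z hz)).add analyticAt_const) (hden z hz)))

/-- The subordination of the principal powers passes to the branches. -/
theorem exists_branchExpr_eq_comp {α μ : ℝ} (hμ0 : 0 < μ) (hμ1 : μ ≤ 1) {β γ δ : ℂ}
    {p q lp lq : ℂ → ℂ} (hp : ClassR α β γ δ μ p) (hq : ClassR α β γ δ μ q)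
    (hlp : AnalyticDisk lp) (hlp0 : lp 0 = 0) (hlpe : ∀ z ∈ unitDisk, Complex.exp (lp z) = p z)
    (hlq : AnalyticDisk lq) (hlq0 : lq 0 = 0) (hlqe : ∀ z ∈ unitDisk, Complex.exp (lq z) = q z)
    (hs : Subordinate (diffExpr α β γ δ μ p) (diffExpr α β γ δ μ q)) :
    ∃ w : ℂ → ℂ, (∀ z ∈ unitDisk, ‖w z‖ ≤ ‖z‖) ∧ ∀ z ∈ unitDisk,
      branchExpr ((α : ℂ) / μ) β γ δ lp p z = branchExpr ((α : ℂ) / μ) β γ δ lq q (w z) := by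
  obtain ⟨-, -, w, hw, hw0, hw1, hweq⟩ := hs
  have h0mem : (0 : ℂ) ∈ unitDisk := Metric.mem_ball_self one_pos
  refine ⟨w, fun z hz => ?_, ?_⟩
  · exact Complex.norm_le_norm_of_mapsTo_ball (R := 1) hw.differentiableOn
      (fun x hx => by simpa using (hw1 x hx).le) hw0 (by simpa using hz)
  obtain ⟨Ψ, hΨ⟩ := exists_eventually_branchExpr_eq (α := α) hμ0 hμ1 β γ δ
  have hGp := analyticDisk_branchExpr (a := (α : ℂ) / μ) (δ := δ) hlp hp.analytic hp.denom_ne_zero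
  have hGq := analyticDisk_branchExpr (a := (α : ℂ) / μ) (δ := δ) hlq hq.analytic hq.denom_ne_zero
  refine hGp.eqOn_of_preconnected_of_eventuallyEq
    (g := fun z => branchExpr ((α : ℂ) / μ) β γ δ lq q (w z))
    (fun z hz => (hGq (w z) (by simpa using hw1 z hz)).comp (hw z hz))
    (convex_ball (0 : ℂ) 1).isPreconnected h0mem ?_
  have hwc : Filter.Tendsto w (nhds 0) (nhds 0) := by
    have := (hw 0 h0mem).continuousAt.tendsto
    rwa [hw0] at this
  filter_upwards [Metric.ball_mem_nhds _ one_pos, hΨ p lp hlp hlp0 hlpe,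
    hwc.eventually (hΨ q lq hlq hlq0 hlqe)] with z hz h1 h2
  rw [h1, h2, hweq z hz]

/-- Both sides are logarithms of `p` vanishing at `0`: they agree near `0`, hence on the closed disk
by the identity theorem. This equates the factors `p ^ a` and `q ^ a` at the touching point. -/
theorem log_comp_eq {p q lp lq v : ℂ → ℂ} {r : ℝ} (hr0 : 0 ≤ r) (hr : r < 1)
    (hlp : AnalyticDisk lp) (hlp0 : lp 0 = 0) (hlpe : ∀ z ∈ unitDisk, Complex.exp (lp z) = p z)
    (hlq : AnalyticDisk lq) (hlq0 : lq 0 = 0) (hlqe : ∀ z ∈ unitDisk, Complex.exp (lq z) = q z)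
    (hv : AnalyticOnNhd ℂ v (Metric.closedBall 0 r))
    (hvm : Set.MapsTo v (Metric.closedBall 0 r) unitDisk) (hv0 : v 0 = 0)
    (hvq : ∀ x ∈ Metric.closedBall 0 r, q (v x) = p x) {z : ℂ} (hz : ‖z‖ ≤ r) :
    lq (v z) = lp z := by
  have hsub : Metric.closedBall (0 : ℂ) r ⊆ unitDisk := Metric.closedBall_subset_ball hr
  have h0mem : (0 : ℂ) ∈ Metric.closedBall (0 : ℂ) r := by simpa using hr0
  rcases hr0.eq_or_lt with rfl | hrpos
  · obtain rfl : z = 0 := by simpa using hz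
    rw [hv0, hlq0, hlp0]
  have hcomp : AnalyticOnNhd ℂ (fun x => lq (v x)) (Metric.closedBall 0 r) :=
    fun x hx => (hlq (v x) (hvm hx)).comp (hv x hx)
  refine hcomp.eqOn_of_preconnected_of_eventuallyEq (hlp.mono hsub)
    (convex_closedBall (0 : ℂ) r).isPreconnected h0mem ?_ (by simpa using hz)
  filter_upwards [Metric.closedBall_mem_nhds _ hrpos,
    eventually_abs_im_lt (hcomp 0 h0mem).continuousAt (by simp [hv0, hlq0]) 1 Real.pi_pos,
    eventually_abs_im_lt (hlp 0 (hsub h0mem)).continuousAt hlp0 1 Real.pi_pos] with x hx h1 h2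
  rw [one_mul] at h1 h2
  rw [← log_exp_of_abs_im_lt h1, ← log_exp_of_abs_im_lt h2, hlqe _ (hvm hx), hlpe _ (hsub hx),
    hvq x hx]

end Branch

/-! ### The subordination theorem and the best dominant. -/

theorem subordinate_of_diffExpr_subordinate {α μ : ℝ} (hμ0 : 0 < μ) (hμ1 : μ ≤ 1)
    {β γ δ : ℂ} {p q : ℂ → ℂ} (hqR : ClassR α β γ δ μ q) (hq : UnivalentDisk q)
    (h₁ : ∀ z ∈ unitDisk,
      0 < ((β * q z + γ) * (1 + (α : ℂ) / (μ : ℂ) + (α : ℂ) * δ / ((μ : ℂ) * q z))).re)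
    (h₂ : ∀ z ∈ unitDisk, z ≠ 0 →
      0 < ((α : ℂ) / (μ : ℂ) * (z * deriv q z / q z)
        + z * deriv (bbTerm β γ q) z / bbTerm β γ q z).re)
    (hpR : ClassR α β γ δ μ p)
    (hs : Subordinate (diffExpr α β γ δ μ p) (diffExpr α β γ δ μ q)) : Subordinate p q := by
  have hμc : (μ : ℂ) ≠ 0 := by exact_mod_cast hμ0.ne'
  obtain ⟨lp, hlp, hlp0, hlpe⟩ := exists_analytic_log_unitDisk hpR.analytic hpR.ne_zero
  obtain ⟨lq, hlq, hlq0, hlqe⟩ := exists_analytic_log_unitDisk hqR.analytic hqR.ne_zero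
  rw [hpR.map_zero, Complex.log_one] at hlp0
  rw [hqR.map_zero, Complex.log_one] at hlq0
  obtain ⟨w, hw, hwG⟩ := exists_branchExpr_eq_comp hμ0 hμ1 hpR hqR hlp hlp0 hlpe hlq hlq0 hlqe hs
  set a : ℂ := (α : ℂ) / μ with ha
  have hq' : ∀ z ∈ unitDisk, deriv q z ≠ 0 := fun z hz =>
    deriv_ne_zero_of_injOn Metric.isOpen_ball hq.1 hq.2 hz
  obtain ⟨L, hL, -, hLe⟩ := exists_analytic_log_unitDisk
    (f := fun z => deriv q z * Complex.exp (a * lq z) / (β * q z + γ))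
    (fun z hz => ((hq.1 z hz).deriv.mul (analyticAt_const.mul (hlq z hz)).cexp).div
      ((analyticAt_const.mul (hq.1 z hz)).add analyticAt_const) (hqR.denom_ne_zero z hz))
    (fun z hz => div_ne_zero (mul_ne_zero (hq' z hz) (Complex.exp_ne_zero _))
      (hqR.denom_ne_zero z hz))
  obtain ⟨k, -, -, hk⟩ := exists_primitive_unitDisk
    (f := fun z => Complex.exp (L z)) (fun z hz => (hL z hz).cexp) 0
  have hdL : ∀ z ∈ unitDisk, HasDerivAt L (deriv L z) z :=
    fun z hz => (hL z hz).differentiableAt.hasDerivAt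
  have hdq : ∀ z ∈ unitDisk, HasDerivAt q (deriv q z) z :=
    fun z hz => (hq.1 z hz).differentiableAt.hasDerivAt
  have hdlq : ∀ z ∈ unitDisk, HasDerivAt lq (deriv q z / q z) z := by
    intro z hz
    have h1 := (hlq z hz).differentiableAt.hasDerivAt
    have h2 := h1.cexp.congr_of_eventuallyEq (f₁ := q) (by
      filter_upwards [Metric.isOpen_ball.mem_nhds hz] with x hx using (hlqe x hx).symm)
    refine h1.congr_deriv (eq_div_of_mul_eq (hqR.ne_zero z hz) ?_)
    rw [(hdq z hz).unique h2, hlqe z hz, mul_comm]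
  -- As `R = z e ^ (L - a log q)`, one has `z R' / R = 1 + z L' - a z q' / q`, and the `a`-term
  -- cancels in `h₂`.
  have hre : ∀ z ∈ unitDisk, 0 < (1 + z * deriv L z).re := by
    intro z hz
    rcases eq_or_ne z 0 with rfl | hz0
    · simp
    have hR : ∀ x ∈ unitDisk, bbTerm β γ q x = x * Complex.exp (L x - a * lq x) := by
      intro x hx
      rw [Complex.exp_sub, hLe x hx, bbTerm]
      have := Complex.exp_ne_zero (a * lq x)
      have := hqR.denom_ne_zero x hx
      field_simp
    have h3 := ((hasDerivAt_id z).mul ((hdL z hz).sub ((hdlq z hz).const_mul a)).cexp)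
    have h4 := h3.congr_of_eventuallyEq (f₁ := bbTerm β γ q) (by
      filter_upwards [Metric.isOpen_ball.mem_nhds hz] with x hx using hR x hx)
    have h5 := h₂ z hz hz0
    rw [h4.deriv, hR z hz] at h5
    convert h5 using 2
    have := Complex.exp_ne_zero (L z - a * lq z)
    have := hqR.ne_zero z hz
    simp only [id, Pi.sub_apply]
    field_simp
    ring
  -- Differentiate `q ^ a * (q + δ) + z e ^ L`; the cofactor of `e ^ L` is the sum of the two
  -- quantities with positive real part.
  have hh : ∀ z ∈ unitDisk, HasDerivAt (branchExpr a β γ δ lq q)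
      (Complex.exp (L z) * ((β * q z + γ) * (1 + a + (α : ℂ) * δ / ((μ : ℂ) * q z)) +
        (1 + z * deriv L z))) z := by
    intro z hz
    have h1 := ((((hdlq z hz).const_mul a).cexp).mul ((hdq z hz).add_const δ)).add
      ((hasDerivAt_id z).mul (hdL z hz).cexp)
    have h2 := h1.congr_of_eventuallyEq (f₁ := branchExpr a β γ δ lq q) (by
      filter_upwards [Metric.isOpen_ball.mem_nhds hz] with x hx
      simp only [branchExpr, Pi.add_apply, Pi.mul_apply, id, hLe x hx]
      ring)
    refine h2.congr_deriv ?_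
    have hden := hqR.denom_ne_zero z hz
    have hqz := hqR.ne_zero z hz
    have e1 : (α : ℂ) * δ / ((μ : ℂ) * q z) = a * δ / q z := by
      rw [ha]; field_simp
    simp only [id]
    rw [e1, hLe z hz]
    generalize β * q z + γ = D at hden ⊢
    field_simp
    ring
  refine subordinate_of_image_subset hq hpR.analytic (hpR.map_zero.trans hqR.map_zero.symm)
    fun z₁ hz₁ => ?_
  by_contra hcon
  obtain ⟨z, ζ, v, m, hζ, hzζ, hm, hmeq, hv, hvm, hv0, hvz, hvq⟩ := exists_touching_point hq
    hpR.analytic (hpR.map_zero.trans hqR.map_zero.symm) hz₁ hcon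
  have hζ1 : ‖ζ‖ < 1 := by simpa using hζ
  have hz1 : ‖z‖ < 1 := hzζ.trans hζ1
  have hz : z ∈ unitDisk := by simpa using hz1
  have hlog := log_comp_eq (norm_nonneg z) hz1 hlp hlp0 hlpe hlq hlq0 hlqe hv hvm hv0 hvq le_rfl
  have hpq : q ζ = p z := by rw [← hvz]; exact hvq z (by simp)
  rw [hvz] at hlog
  refine ne_add_ray_of_closeToConvex hL hk hre hh
    (fun x hx => by rw [Complex.add_re]; exact add_pos (h₁ x hx) (hre x hx))
    hζ ((hw z hz).trans_lt hzζ) (sub_nonneg.2 hm) ?_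
  rw [← hwG z hz]
  simp only [branchExpr]
  rw [hmeq, ← hpq, ← hlog, hLe ζ hζ]
  push_cast
  ring

theorem theorem1 (α μ : ℝ) (hμ0 : 0 < μ) (hμ1 : μ ≤ 1) (hαμ : 0 ≤ α + μ)
    (β γ δ : ℂ) (hβ : β ≠ 0) (q : ℂ → ℂ)
    (hqR : ClassR α β γ δ μ q) (hq : UnivalentDisk q)
    (h₁ : ∀ z ∈ unitDisk,
      0 < ((β * q z + γ) * (1 + (α : ℂ) / (μ : ℂ) + (α : ℂ) * δ / ((μ : ℂ) * q z))).re)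
    -- at `z = 0` the expression below has a removable singularity with value `1`
    (h₂ : ∀ z ∈ unitDisk, z ≠ 0 →
      0 < ((α : ℂ) / (μ : ℂ) * (z * deriv q z / q z)
        + z * deriv (bbTerm β γ q) z / bbTerm β γ q z).re) :
    (∀ p : ℂ → ℂ, ClassR α β γ δ μ p →
      Subordinate (diffExpr α β γ δ μ p) (diffExpr α β γ δ μ q) → Subordinate p q) ∧
    IsBestDominant
      {p : ℂ → ℂ | ClassR α β γ δ μ p ∧
        Subordinate (diffExpr α β γ δ μ p) (diffExpr α β γ δ μ q)} q := by
  have hmain : ∀ p : ℂ → ℂ, ClassR α β γ δ μ p →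
      Subordinate (diffExpr α β γ δ μ p) (diffExpr α β γ δ μ q) → Subordinate p q :=
    fun p hp hs => subordinate_of_diffExpr_subordinate hμ0 hμ1 hqR hq h₁ h₂ hp hs
  -- Since `q` is itself a solution, with Schwarz function the identity, every dominant dominates
  -- it.
  refine ⟨hmain, hq, ⟨hq.1, fun p hp => hmain p hp.1 hp.2⟩, fun r hr => hr.2 q ⟨hqR, ?_⟩⟩
  exact ⟨hqR.analytic_diffExpr, hqR.analytic_diffExpr, id, fun z _ => analyticAt_id, rfl,
    fun z hz => by simpa using hz, fun z _ => rfl⟩
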